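/- **Setting.** Let $n,d\ge 1$, $k\ge 0$, $A\in\mathbb C^{k\times k}$, $B\in\mathbb C^{k\times n}$, $C\in\mathbb C^{n\times k}$, $P_0,\dots,P_d\in\mathbb C^{n\times n}$ ($P_d=0$ is allowed), $P(s)=\sum_{j=0}^d s^jP_j$, and $$R(s)=P(s)+C(sI-A)^{-1}B .$$ Let $\eta_1(s)\ge\dots\ge\eta_n(s)$ be the eigenvalues of $R(s)^*R(s)$. A point $\lambda_*$ that is not an eigenvalue of $A$ is called a simple eigenvalue of $R$ if $R(\lambda_*)v=0$ for some $v\ne0$ and $\eta_1(\lambda_*),\dots,\eta_{n-1}(\lambda_*)>0$. Let $\sigma_{\min}$ denote the smallest singular value of a square matrix ($+\infty$ for the empty matrix). For $V,W\in\mathbb C^{k\times r}$ let $L^{W,V}(s)=\mathcal A^{W,V}-s\,\mathcal B^{W,V}$ be the pencil of size $r+nd$ with $$\mathcal A^{W,V}=\begin{bmatrix}W^*AV&&&&W^*B\\ CV&P_{d-1}&P_{d-2}&\cdots&P_0\\ &-I_n&0&\cdots&0\\ &&\ddots&\ddots&\vdots\\ &&&-I_n&0\end{bmatrix},\qquad \mathcal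 B^{W,V}=\operatorname{diag}(W^*V,\,-P_d,\,-I_n,\dots,-I_n);$$ a number $s\in\mathbb C$ is an eigenvalue of it if $L^{W,V}(s)z=0$ for some $z\neq 0$. **Subspace method.** Given an integer $q\ge 2$ and a target $\tau\in\mathbb C$, put $\lambda_0=\tau$. In iteration $\ell=0,1,2,\dots$ (where $A-\lambda_\ell I$ has to be invertible) put $$\widetilde V_\ell=\big[(A-\lambda_\ell I)^{-1}B,\ \dots,\ (A-\lambda_\ell I)^{-q}B\big],\qquad \widetilde W_\ell=\big[(A-\lambda_\ell I)^{-*}C^*,\ \dots,\ \big((A-\lambda_\ell I)^{-*}\big)^{q}C^*\big],$$ let $V_\ell$ and $W_\ell$ be matrices whose columns form orthonormal bases of the column spaces of $[V_{\ell-1}\ \widetilde V_\ell]$ and $[W_{\ell-1}\ \widetilde W_\ell]$ (of $\widetilde V_0$ and $\widetilde W_0$ if $\ell=0$), these two spaces being of equal dimension, and let $\lambda_{\ell+1}$ be an eigenvalue of $L^{W_\ell,V_\ell}$ closest to $\tau$. **Theorem 2.3 (Quadratic convergence).** Let $\lambda_*\in\mathbb C$ be a simple eigenvalue of $R$ and let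 $\xi>0$ be such that $\sigma_{\min}(A-\lambda_*I)\ge\xi$. Suppose that the Hessian $$\nabla^2\eta_n(\lambda_*)=\begin{bmatrix}\dfrac{\partial^2\eta_n}{\partial(\operatorname{Re}s)^2}&\dfrac{\partial^2\eta_n}{\partial\operatorname{Re}s\,\partial\operatorname{Im}s}\\[2mm]\dfrac{\partial^2\eta_n}{\partial\operatorname{Im}s\,\partial\operatorname{Re}s}&\dfrac{\partial^2\eta_n}{\partial(\operatorname{Im}s)^2}\end{bmatrix}(\lambda_*)$$ is invertible. Then there are constants $K>0$ and $\delta>0$, depending only on $A,B,C,P_0,\dots,P_d$, $\lambda_*$ and $\xi$, such that the following holds for all integers $q\ge2$, all targets $\tau\in\mathbb C$, all runs of the subspace method and all $\ell\ge0$ for which the iterations $0,\dots,\ell$ have been carried out: if $$\sigma_{\min}\big(W_\ell^*AV_\ell-\lambda_*W_\ell^*V_\ell\big)\ge\xi,\qquad |\lambda_\ell-\lambda_*|<\delta,\qquad |\lambda_{\ell+1}-\lambda_*|<\delta,$$ then $$|\lambda_{\ell+1}-\lambda_*|\le K\,|\lambda_\ell-\lambda_*|^2 .$$ -/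

import Mathlib

noncomputable section

namespace RationalEig

open Matrix

/-! ### Singular values -/

/-- The `j`-th eigenvalue of `Mᴴ * M`, in descending order (`j = 0` is the largest one and
`j = n - 1` the smallest one). These are the squared singular values of `M`. -/
def eta {m n : ℕ} (M : Matrix (Fin m) (Fin n) ℂ) (j : Fin n) : ℝ :=
  (Matrix.isHermitian_conjTranspose_mul_self M).eigenvalues₀
    (Fin.cast (Fintype.card_fin n).symm j)

/-- The smallest singular value of a square matrix. It is an extended real number, so that the
empty matrix (which has no singular value) gets `⊤`. -/
def sigmaMin {r : ℕ} (M : Matrix (Fin r) (Fin r) ℂ) : EReal :=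
  ⨅ j : Fin r, ((Real.sqrt (eta M j) : ℝ) : EReal)

/-! ### The Hessian of a real function of a complex variable -/

/-- The `2 × 2` matrix of second partial derivatives of `f` with respect to `Re s` and `Im s`,
as the matrix of the second real Fréchet derivative in the basis `1, i` of `ℂ`. -/
def hessian (f : ℂ → ℝ) (s : ℂ) : Matrix (Fin 2) (Fin 2) ℝ :=
  Matrix.of fun a b =>
    fderiv ℝ (fun z : ℂ => fderiv ℝ f z) s (![1, Complex.I] a) (![1, Complex.I] b)

/-! ### Rational matrix functions in transfer function form -/

/-- The data of `R(s) = P(s) + C (s I - A)⁻¹ B`, where `P(s) = ∑ j ≤ d, s ^ j • P j`. The leading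
coefficient `P d` may vanish, so a constant `P` is covered by `d = 1` and `P 1 = 0`. -/
structure RatFun (k n d : ℕ) where
  A : Matrix (Fin k) (Fin k) ℂ
  B : Matrix (Fin k) (Fin n) ℂ
  C : Matrix (Fin n) (Fin k) ℂ
  P : Fin (d + 1) → Matrix (Fin n) (Fin n) ℂ

/-- The value `R(s)`. It is meaningful when `s` is not an eigenvalue of `A`. -/
def RatFun.eval {k n d : ℕ} (R : RatFun k n d) (s : ℂ) : Matrix (Fin n) (Fin n) ℂ :=
  (∑ j : Fin (d + 1), s ^ (j : ℕ) • R.P j) + R.C * (s • (1 : Matrix (Fin k) (Fin k) ℂ) - R.A)⁻¹ * R.B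

/-- The smallest eigenvalue `η_n(s)` of `R(s)ᴴ R(s)`. -/
def RatFun.etaLast {k n d : ℕ} (R : RatFun k n d) (hn : 0 < n) (s : ℂ) : ℝ :=
  eta (R.eval s) ⟨n - 1, Nat.sub_lt hn Nat.one_pos⟩

/-- `s` is a simple eigenvalue of `R`: the matrix `R(s)` is singular, and among the eigenvalues of
`R(s)ᴴ R(s)` only the smallest one vanishes. -/
def RatFun.IsSimpleEigenvalue {k n d : ℕ} (R : RatFun k n d) (s : ℂ) : Prop :=
  (∃ v : Fin n → ℂ, v ≠ 0 ∧ R.eval s *ᵥ v = 0) ∧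
    ∀ j : Fin n, (j : ℕ) + 1 < n → 0 < eta (R.eval s) j

/-! ### The linearization of the (projected) rational eigenvalue problem -/

/-- The constant coefficient of the linearization of `P(s) + C (s F - A)⁻¹ B`: the block matrix
whose block rows are `[A, 0, …, 0, B]`, `[C, P_{d-1}, …, P_0]`, `[0, -I, 0, …]`, …,
`[0, …, -I, 0]`. The index `(i, a)` is the row or column `a` of the `i`-th block of size `n`. -/
def pencilConst {r n d : ℕ} (A : Matrix (Fin r) (Fin r) ℂ) (B : Matrix (Fin r) (Fin n) ℂ)
    (C : Matrix (Fin n) (Fin r) ℂ) (P : Fin (d + 1) → Matrix (Fin n) (Fin n) ℂ) :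
    Matrix (Fin r ⊕ Fin d × Fin n) (Fin r ⊕ Fin d × Fin n) ℂ :=
  Matrix.fromBlocks A
    (Matrix.of fun i jb => if (jb.1 : ℕ) + 1 = d then B i jb.2 else 0)
    (Matrix.of fun ia j => if (ia.1 : ℕ) = 0 then C ia.2 j else 0)
    (Matrix.of fun ia jb =>
      if (ia.1 : ℕ) = 0 then P jb.1.rev.castSucc ia.2 jb.2
      else if (ia.1 : ℕ) = (jb.1 : ℕ) + 1 ∧ ia.2 = jb.2 then -1 else 0)

/-- The linear coefficient of the linearization of `P(s) + C (s F - A)⁻¹ B`: the block diagonal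
matrix with diagonal blocks `F, -P_d, -I, …, -I`. -/
def pencilLin {r n d : ℕ} (F : Matrix (Fin r) (Fin r) ℂ)
    (P : Fin (d + 1) → Matrix (Fin n) (Fin n) ℂ) :
    Matrix (Fin r ⊕ Fin d × Fin n) (Fin r ⊕ Fin d × Fin n) ℂ :=
  Matrix.fromBlocks F 0 0
    (Matrix.of fun ia jb =>
      if ia.1 = jb.1 then
        (if (ia.1 : ℕ) = 0 then -P (Fin.last d) ia.2 jb.2
        else if ia.2 = jb.2 then -1 else 0)
      else 0)

/-- The projected pencil `L^{W,V}(s) = 𝒜^{W,V} - s ℬ^{W,V}`, obtained from the linearization by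
replacing `A, B, C, F` with `Wᴴ A V, Wᴴ B, C V, Wᴴ V`. -/
def RatFun.projPencil {k n d r : ℕ} (R : RatFun k n d) (V W : Matrix (Fin k) (Fin r) ℂ) (s : ℂ) :
    Matrix (Fin r ⊕ Fin d × Fin n) (Fin r ⊕ Fin d × Fin n) ℂ :=
  pencilConst (Wᴴ * R.A * V) (Wᴴ * R.B) (R.C * V) R.P - s • pencilLin (Wᴴ * V) R.P

/-- `s` is a (finite) eigenvalue of the projected pencil. -/
def RatFun.IsProjEigenvalue {k n d r : ℕ} (R : RatFun k n d) (V W : Matrix (Fin k) (Fin r) ℂ)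
    (s : ℂ) : Prop :=
  ∃ z : Fin r ⊕ Fin d × Fin n → ℂ, z ≠ 0 ∧ R.projPencil V W s *ᵥ z = 0

/-! ### The subspace method -/

/-- `[(A - μ I)⁻¹ B, (A - μ I)⁻² B, …, (A - μ I)^{-q} B]`. -/
def RatFun.rightExpansion {k n d : ℕ} (R : RatFun k n d) (q : ℕ) (μ : ℂ) :
    Matrix (Fin k) (Fin q × Fin n) ℂ :=
  Matrix.of fun i jb =>
    (((R.A - μ • (1 : Matrix (Fin k) (Fin k) ℂ))⁻¹) ^ ((jb.1 : ℕ) + 1) * R.B) i jb.2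

/-- `[(A - μ I)^{-*} C^*, (A - μ I)^{-2*} C^*, …, (A - μ I)^{-q*} C^*]`. -/
def RatFun.leftExpansion {k n d : ℕ} (R : RatFun k n d) (q : ℕ) (μ : ℂ) :
    Matrix (Fin k) (Fin q × Fin n) ℂ :=
  Matrix.of fun i jb =>
    ((((R.A - μ • (1 : Matrix (Fin k) (Fin k) ℂ))⁻¹)ᴴ) ^ ((jb.1 : ℕ) + 1) * R.Cᴴ) i jb.2

/-- `Q` is a possible value of `orth(M)`: the columns of `Q` form an orthonormal basis of the
column space of `M`. -/
def IsOrth {k r : ℕ} {ι : Type} [Fintype ι] (Q : Matrix (Fin k) (Fin r) ℂ)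
    (M : Matrix (Fin k) ι ℂ) : Prop :=
  Qᴴ * Q = 1 ∧ LinearMap.range Q.mulVecLin = LinearMap.range M.mulVecLin

/-- The iterations `0, 1, …, N` of the subspace method with interpolation parameter `q` and target
`τ` have been carried out: `lam` are the eigenvalue estimates (those with index at most `N + 1`
matter), and `V l`, `W l` are the bases formed in iteration `l` (those with `l ≤ N` matter),
spanning subspaces of the same dimension `r l`. The orthonormal bases, and the choice among several
closest eigenvalues, are left free. -/
structure RatFun.IsRun {k n d : ℕ} (R : RatFun k n d) (q : ℕ) (τ : ℂ) (N : ℕ) (lam : ℕ → ℂ)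
    (r : ℕ → ℕ) (V W : (l : ℕ) → Matrix (Fin k) (Fin (r l)) ℂ) : Prop where
  start : lam 0 = τ
  solvable : ∀ l ≤ N, IsUnit (R.A - lam l • (1 : Matrix (Fin k) (Fin k) ℂ))
  right_zero : IsOrth (V 0) (R.rightExpansion q (lam 0))
  left_zero : IsOrth (W 0) (R.leftExpansion q (lam 0))
  right_succ : ∀ l, l + 1 ≤ N →
    IsOrth (V (l + 1)) (Matrix.fromCols (V l) (R.rightExpansion q (lam (l + 1))))
  left_succ : ∀ l, l + 1 ≤ N →
    IsOrth (W (l + 1)) (Matrix.fromCols (W l) (R.leftExpansion q (lam (l + 1))))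
  eigenvalue : ∀ l ≤ N, R.IsProjEigenvalue (V l) (W l) (lam (l + 1))
  closest : ∀ l ≤ N, ∀ μ : ℂ, R.IsProjEigenvalue (V l) (W l) μ → ‖lam (l + 1) - τ‖ ≤ ‖μ - τ‖

end RationalEig

end

open Matrix

namespace RationalEig

/-! Two estimates for the smallest singular value of `R(s)` at the new iterate `s`, with previous
iterate `μ`, are played against each other. From below, `η_n` is nonnegative and `O(|s - λ_*|²)`, so
its value and gradient vanish at `λ_*`. An invertible Hessian at a minimum is positive definite,
hence `η_n(s) ≥ c |s - λ_*|²` nearby (`RatFun.exists_le_etaLast`). From above, an eigenvector of the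
projected pencil yields `v ≠ 0` in the kernel of the reduced rational function at `s`. The right
subspace contains the first two Krylov directions at `μ`, so `R` and its reduction applied to `v`
differ by `O(|s - μ|²) ‖v‖` (`RatFun.euclNorm_eval_mulVec_le`). Since `η_n(s) ‖v‖² ≤ ‖R(s) v‖²`,
this gives `|s - λ_*| ≤ L |s - μ|²`. The triangle inequality and a small `δ` turn it into the claim.
All constants come from lower bounds on `A - s` and on the projected matrix, uniform over runs. -/

/-- The Euclidean norm of a plain coordinate vector. -/
noncomputable def euclNorm {ι : Type*} [Fintype ι] (v : ι → ℂ) : ℝ := ‖WithLp.toLp 2 v‖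

/-! ### Euclidean norms and matrices with orthonormal columns. -/

section euclNorm

variable {ι κ : Type*} [Fintype ι] [Fintype κ]

theorem euclNorm_nonneg (v : ι → ℂ) : 0 ≤ euclNorm v := norm_nonneg _

theorem euclNorm_eq_zero {v : ι → ℂ} : euclNorm v = 0 ↔ v = 0 := by
  simp [euclNorm]

theorem euclNorm_pos {v : ι → ℂ} (hv : v ≠ 0) : 0 < euclNorm v :=
  (euclNorm_nonneg v).lt_of_ne' fun h => hv (euclNorm_eq_zero.1 h)

theorem euclNorm_add_le (v w : ι → ℂ) : euclNorm (v + w) ≤ euclNorm v + euclNorm w := by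
  simpa [euclNorm] using norm_add_le (WithLp.toLp 2 v) (WithLp.toLp 2 w)

theorem euclNorm_smul (c : ℂ) (v : ι → ℂ) : euclNorm (c • v) = ‖c‖ * euclNorm v := by
  simp [euclNorm, norm_smul]

theorem euclNorm_neg (v : ι → ℂ) : euclNorm (-v) = euclNorm v := by
  simp [euclNorm]

theorem sub_euclNorm_le (v w : ι → ℂ) : euclNorm v - euclNorm w ≤ euclNorm (v - w) := by
  simpa [euclNorm] using norm_sub_norm_le (WithLp.toLp 2 v) (WithLp.toLp 2 w)

theorem star_dotProduct_self (v : ι → ℂ) : star v ⬝ᵥ v = ((euclNorm v ^ 2 : ℝ) : ℂ) := by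
  have h := inner_self_eq_norm_sq_to_K (𝕜 := ℂ) (WithLp.toLp 2 v)
  rw [EuclideanSpace.inner_eq_star_dotProduct, dotProduct_comm] at h
  simpa [euclNorm] using h

theorem exists_euclNorm_mulVec_le (M : Matrix ι κ ℂ) :
    ∃ K : ℝ, 0 < K ∧ ∀ v, euclNorm (M *ᵥ v) ≤ K * euclNorm v := by
  classical
  obtain ⟨K, hK, h⟩ :=
    (LinearMap.toContinuousLinearMap (Matrix.toLpLin 2 2 M)).bound
  exact ⟨K, hK, fun v => by simpa [euclNorm] using h (WithLp.toLp 2 v)⟩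

theorem euclNorm_mulVec_of_conjTranspose_mul_self_eq_one [DecidableEq κ] {W : Matrix ι κ ℂ}
    (hW : Wᴴ * W = 1) (v : κ → ℂ) : euclNorm (W *ᵥ v) = euclNorm v := by
  have h : star (W *ᵥ v) ⬝ᵥ (W *ᵥ v) = star v ⬝ᵥ v := by
    rw [star_mulVec, ← dotProduct_mulVec, mulVec_mulVec, hW, one_mulVec]
  rw [star_dotProduct_self, star_dotProduct_self] at h
  exact (sq_eq_sq₀ (euclNorm_nonneg _) (euclNorm_nonneg _)).1 (by exact_mod_cast h)

theorem euclNorm_conjTranspose_mulVec_le [DecidableEq κ] {W : Matrix ι κ ℂ}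
    (hW : Wᴴ * W = 1) (v : ι → ℂ) : euclNorm (Wᴴ *ᵥ v) ≤ euclNorm v := by
  have h : star (Wᴴ *ᵥ v) ⬝ᵥ (Wᴴ *ᵥ v) = star v ⬝ᵥ (W *ᵥ (Wᴴ *ᵥ v)) := by
    rw [star_mulVec, ← dotProduct_mulVec, conjTranspose_conjTranspose]
  have h2 : ‖star v ⬝ᵥ (W *ᵥ (Wᴴ *ᵥ v))‖ ≤ euclNorm v * euclNorm (W *ᵥ (Wᴴ *ᵥ v)) := by
    have := norm_inner_le_norm (𝕜 := ℂ) (WithLp.toLp 2 v) (WithLp.toLp 2 (W *ᵥ (Wᴴ *ᵥ v)))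
    rwa [EuclideanSpace.inner_eq_star_dotProduct, dotProduct_comm] at this
  rw [← h, star_dotProduct_self, euclNorm_mulVec_of_conjTranspose_mul_self_eq_one hW,
    Complex.norm_real, Real.norm_of_nonneg (sq_nonneg _)] at h2
  rcases (euclNorm_nonneg (Wᴴ *ᵥ v)).eq_or_lt with h0 | h0
  · rw [← h0]; exact euclNorm_nonneg _
  · exact le_of_mul_le_mul_right (by nlinarith) h0

end euclNorm

/-! ### Singular values and lower bounds -/

/-- Expand `v` in an orthonormal eigenbasis of `Mᴴ * M`: the coefficients of `‖M v‖²` are those of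
`‖v‖²` weighted by the eigenvalues. -/
theorem mul_euclNorm_sq_le_of_le_eta {m n : ℕ} (M : Matrix (Fin m) (Fin n) ℂ) {c : ℝ}
    (hc : ∀ j, c ≤ eta M j) (v : Fin n → ℂ) : c * euclNorm v ^ 2 ≤ euclNorm (M *ᵥ v) ^ 2 := by
  have hA := Matrix.isHermitian_conjTranspose_mul_self M
  have hc' : ∀ i, c ≤ hA.eigenvalues i := fun i => by
    have := hc (Fin.cast (Fintype.card_fin n) ((Fintype.equivOfCardEq (Fintype.card_fin _)).symm i))
    simpa [eta, Matrix.IsHermitian.eigenvalues] using this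
  set b := hA.eigenvectorBasis
  have h1 : ((euclNorm (M *ᵥ v) ^ 2 : ℝ) : ℂ)
      = inner ℂ (WithLp.toLp 2 v) (WithLp.toLp 2 ((Mᴴ * M) *ᵥ v)) := by
    rw [← star_dotProduct_self, EuclideanSpace.inner_eq_star_dotProduct,
      star_mulVec, ← dotProduct_mulVec, mulVec_mulVec, dotProduct_comm]
  have h2 : ∀ i, inner ℂ (b i) (WithLp.toLp 2 ((Mᴴ * M) *ᵥ v))
      = (hA.eigenvalues i : ℂ) * inner ℂ (b i) (WithLp.toLp 2 v) := by
    intro i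
    have := hA.mulVec_eigenvectorBasis i
    rw [EuclideanSpace.inner_eq_star_dotProduct, EuclideanSpace.inner_eq_star_dotProduct,
      dotProduct_comm]
    have h3 : star (b i).ofLp ⬝ᵥ ((Mᴴ * M) *ᵥ v) = star ((Mᴴ * M) *ᵥ (b i).ofLp) ⬝ᵥ v := by
      rw [star_mulVec, hA.eq, dotProduct_mulVec]
    rw [h3, this, star_smul, smul_dotProduct, dotProduct_comm]
    simp [b]
  have h4 : euclNorm (M *ᵥ v) ^ 2
      = ∑ i, hA.eigenvalues i * ‖inner ℂ (b i) (WithLp.toLp 2 v)‖ ^ 2 := by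
    have : ((euclNorm (M *ᵥ v) ^ 2 : ℝ) : ℂ)
      = ((∑ i, hA.eigenvalues i * ‖inner ℂ (b i) (WithLp.toLp 2 v)‖ ^ 2 : ℝ) : ℂ) := by
      rw [h1, ← b.sum_inner_mul_inner, Complex.ofReal_sum]
      refine Finset.sum_congr rfl fun i _ => ?_
      rw [h2, ← inner_conj_symm, Complex.ofReal_mul, Complex.ofReal_pow, ← Complex.conj_mul']
      ring
    exact_mod_cast this
  rw [h4, euclNorm, ← b.sum_sq_norm_inner_right, Finset.mul_sum]
  exact Finset.sum_le_sum fun i _ => mul_le_mul_of_nonneg_right (hc' i) (sq_nonneg _)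

open scoped ComplexOrder in
theorem eta_nonneg {m n : ℕ} (M : Matrix (Fin m) (Fin n) ℂ) (j : Fin n) : 0 ≤ eta M j := by
  have := (Matrix.posSemidef_conjTranspose_mul_self M).eigenvalues_nonneg
    ((Fintype.equivOfCardEq (Fintype.card_fin _)) (Fin.cast (Fintype.card_fin n).symm j))
  simpa [eta, Matrix.IsHermitian.eigenvalues] using this

theorem mul_euclNorm_le_of_le_sigmaMin {r : ℕ} {M : Matrix (Fin r) (Fin r) ℂ} {ξ : ℝ}
    (hξ : 0 ≤ ξ) (h : (ξ : EReal) ≤ sigmaMin M) (v : Fin r → ℂ) :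
    ξ * euclNorm v ≤ euclNorm (M *ᵥ v) := by
  have h1 : ∀ j, ξ ^ 2 ≤ eta M j := fun j => by
    have h2 : ξ ≤ Real.sqrt (eta M j) := EReal.coe_le_coe_iff.1 (h.trans (iInf_le _ j))
    rcases hξ.eq_or_lt with h0 | h0
    · rw [← h0, zero_pow two_ne_zero]
      exact eta_nonneg M j
    · exact (Real.le_sqrt' h0).1 h2
  have := mul_euclNorm_sq_le_of_le_eta M h1 v
  rw [← mul_pow] at this
  exact (sq_le_sq₀ (mul_nonneg hξ (euclNorm_nonneg _)) (euclNorm_nonneg _)).1 this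

theorem RatFun.etaLast_mul_le {k n d : ℕ} (R : RatFun k n d) (hn : 0 < n) (s : ℂ)
    (v : Fin n → ℂ) : R.etaLast hn s * euclNorm v ^ 2 ≤ euclNorm (R.eval s *ᵥ v) ^ 2 := by
  refine mul_euclNorm_sq_le_of_le_eta _ (fun j => ?_) v
  refine Matrix.IsHermitian.eigenvalues₀_antitone _ ?_
  rw [Fin.le_def]
  simp
  omega

/-! ### Quadratic growth at a minimum with injective second derivative -/

/-- The quadratic bound `hO` kills the value and the first derivative, so `f` is half the form `D`
up to `o(‖x - x₀‖²)`. Nonnegativity of `f` makes `D` semidefinite, injectivity makes it definite,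
and compactness of the sphere gives the constant. -/
theorem exists_le_of_fderiv_fderiv_injective {E : Type*} [NormedAddCommGroup E] [NormedSpace ℝ E]
    [FiniteDimensional ℝ E] {f : E → ℝ} {x₀ : E}
    (hf0 : ∀ x, 0 ≤ f x) (hO : f =O[nhds x₀] fun x => ‖x - x₀‖ ^ 2)
    {D : E →L[ℝ] E →L[ℝ] ℝ} (hD : HasFDerivAt (fderiv ℝ f) D x₀)
    (hinj : Function.Injective D) :
    ∃ c > 0, ∀ᶠ x in nhds x₀, c * ‖x - x₀‖ ^ 2 ≤ f x := by
  have hfx : f x₀ = 0 := by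
    have := hO.eq_zero_of_norm_pow (n := 2) (by norm_num)
    simpa using this
  have hder0 : HasFDerivAt f (0 : E →L[ℝ] ℝ) x₀ := hO.hasFDerivAt (by norm_num)
  obtain ⟨m, hm, hmD⟩ : ∃ m > 0, ∀ z, m * ‖z‖ ≤ ‖D z‖ := by
    obtain ⟨K, hK, h⟩ := (D : E →ₗ[ℝ] E →L[ℝ] ℝ).exists_antilipschitzWith
      (LinearMap.ker_eq_bot.2 hinj)
    refine ⟨(K : ℝ)⁻¹, by positivity, fun z => ?_⟩
    have h1 := h.le_mul_dist z 0
    simp only [dist_zero_right, map_zero] at h1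
    rw [inv_mul_le_iff₀ (by exact_mod_cast hK)]
    exact h1
  have hbound : ∀ ε > 0, ∀ᶠ x in nhds x₀, ‖fderiv ℝ f x - D (x - x₀)‖ ≤ ε * ‖x - x₀‖ := by
    intro ε hε
    have := (hasFDerivAt_iff_isLittleO.1 hD).def hε
    simpa [hder0.fderiv] using this
  -- Where `f` is not differentiable `fderiv` is `0`, yet near `x₀` it is close to `D (x - x₀)`,
  -- whose norm is at least `m * ‖x - x₀‖`. Only `x = x₀` could be such a point, and there `f` is
  -- differentiable.
  have hdiff : ∀ᶠ x in nhds x₀, HasFDerivAt f (fderiv ℝ f x) x := by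
    filter_upwards [hbound (m / 2) (by positivity)] with x hx
    by_cases hxd : DifferentiableAt ℝ f x
    · exact hxd.hasFDerivAt
    · rw [fderiv_zero_of_not_differentiableAt hxd, zero_sub, norm_neg] at hx
      have h1 := hmD (x - x₀)
      have h2 : ‖x - x₀‖ = 0 := by
        have := norm_nonneg (x - x₀)
        nlinarith
      rw [norm_eq_zero, sub_eq_zero] at h2
      subst h2
      exact hder0.differentiableAt.hasFDerivAt
  have hsymm : ∀ v w, D v w = D w v := second_derivative_symmetric_of_eventually hdiff hD
  have taylor : ∀ ε > 0, ∀ᶠ x in nhds x₀,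
      |f x - D (x - x₀) (x - x₀) / 2| ≤ ε * ‖x - x₀‖ ^ 2 := by
    intro ε hε
    obtain ⟨ρ, hρ, h⟩ := Metric.eventually_nhds_iff_ball.1 (hdiff.and (hbound ε hε))
    refine Metric.eventually_nhds_iff_ball.2 ⟨ρ, hρ, fun x hx => ?_⟩
    have hsub : Metric.closedBall x₀ ‖x - x₀‖ ⊆ Metric.ball x₀ ρ := by
      refine Metric.closedBall_subset_ball ?_
      simpa [dist_eq_norm] using hx
    -- Mean value inequality for `f` minus its quadratic part, whose derivative is at most `ε * ‖x -
    -- x₀‖` on this ball.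
    have key := Convex.norm_image_sub_le_of_norm_hasFDerivWithin_le (𝕜 := ℝ)
      (f := fun y => f y - D (y - x₀) (y - x₀) / 2)
      (f' := fun y => fderiv ℝ f y - D (y - x₀)) (C := ε * ‖x - x₀‖)
      (s := Metric.closedBall x₀ ‖x - x₀‖) (x := x₀) (y := x) ?_ ?_
      (convex_closedBall _ _) (by simp) (by simp [dist_eq_norm])
    · simpa [hfx, pow_two, mul_assoc] using key
    · intro y hy
      refine HasFDerivAt.hasFDerivWithinAt (((h y (hsub hy)).1).sub ?_)
      have hq := D.hasFDerivAt_of_bilinear ((hasFDerivAt_id y).sub_const x₀)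
        ((hasFDerivAt_id y).sub_const x₀)
      have hq2 := hq.const_mul (1 / 2 : ℝ)
      refine (hq2.congr_fderiv ?_).congr_of_eventuallyEq (Filter.Eventually.of_forall fun z => ?_)
      · ext w
        simp [hsymm w y, hsymm w x₀]
        ring
      · simp; ring
    · intro y hy
      refine (h y (hsub hy)).2.trans (mul_le_mul_of_nonneg_left ?_ hε.le)
      simpa [dist_eq_norm] using hy
  have hnonneg : ∀ z, 0 ≤ D z z := by
    intro z
    by_contra! hz
    have hz0 : z ≠ 0 := by rintro rfl; simp at hz
    have hzn : 0 < ‖z‖ ^ 2 := by positivity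
    -- With this `ε`, Taylor gives `f (x₀ + t • z) ≤ t ^ 2 * D z z / 4 < 0`.
    have hT := taylor (-D z z / (4 * ‖z‖ ^ 2)) (div_pos (by linarith) (by positivity))
    have hlim : Filter.Tendsto (fun t : ℝ => x₀ + t • z) (nhdsWithin 0 (Set.Ioi 0)) (nhds x₀) := by
      have : Filter.Tendsto (fun t : ℝ => x₀ + t • z) (nhds 0) (nhds (x₀ + (0 : ℝ) • z)) :=
        (by fun_prop : Continuous fun t : ℝ => x₀ + t • z).tendsto 0
      rw [zero_smul, add_zero] at this
      exact this.mono_left nhdsWithin_le_nhds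
    obtain ⟨t, ht, ht0⟩ := ((hlim.eventually hT).and self_mem_nhdsWithin).exists
    have ht0 : 0 < t := ht0
    simp only [add_sub_cancel_left, map_smul, _root_.smul_apply, smul_eq_mul,
      norm_smul, mul_pow, Real.norm_eq_abs, sq_abs] at ht
    have h1 := (abs_le.1 ht).2
    have h2 : -D z z / (4 * ‖z‖ ^ 2) * (t ^ 2 * ‖z‖ ^ 2) = -D z z / 4 * t ^ 2 := by
      field_simp
    rw [h2] at h1
    have h3 := hf0 (x₀ + t • z)
    nlinarith [mul_pos ht0 ht0]
  have hpos : ∀ z, z ≠ 0 → 0 < D z z := by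
    intro z hz
    refine (hnonneg z).lt_of_ne' fun h0 => hz (hinj ?_)
    rw [map_zero]
    ext w
    -- Cauchy–Schwarz for a semidefinite form: an isotropic `z` lies in the kernel of `D`.
    have hB := (LinearMap.BilinForm.apply_sq_le_of_symm
      ((ContinuousLinearMap.coeLM ℝ).comp (D : E →ₗ[ℝ] E →L[ℝ] ℝ)) hnonneg ⟨fun v w => hsymm v w⟩ z w)
    have hB' : D z w ^ 2 ≤ D z z * D w w := hB
    rw [h0, zero_mul] at hB'
    simpa using pow_eq_zero_iff (two_ne_zero) |>.1 (le_antisymm hB' (sq_nonneg _))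
  obtain ⟨c, hc, hcD⟩ : ∃ c > 0, ∀ z, c * ‖z‖ ^ 2 ≤ D z z := by
    rcases (Metric.sphere (0 : E) 1).eq_empty_or_nonempty with he | hne
    · refine ⟨1, one_pos, fun z => ?_⟩
      have : z = 0 := by
        by_contra hz
        have : (‖z‖⁻¹ • z) ∈ Metric.sphere (0 : E) 1 := by simp [norm_smul, hz]
        simp [he] at this
      simp [this]
    · have hcont : Continuous fun z => D z z := by fun_prop
      obtain ⟨z₀, hz₀, hmin⟩ := (isCompact_sphere (0 : E) 1).exists_isMinOn hne hcont.continuousOn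
      refine ⟨D z₀ z₀, hpos _ fun h => by simp [h] at hz₀, fun z => ?_⟩
      by_cases hz : z = 0
      · simp [hz]
      have hn : ‖z‖ ≠ 0 := norm_ne_zero_iff.2 hz
      have h1 : D z₀ z₀ ≤ D (‖z‖⁻¹ • z) (‖z‖⁻¹ • z) :=
        hmin (show (‖z‖⁻¹ • z) ∈ Metric.sphere (0 : E) 1 by simp [norm_smul, hz])
      simp only [map_smul, _root_.smul_apply, smul_eq_mul] at h1
      calc D z₀ z₀ * ‖z‖ ^ 2 ≤ (‖z‖⁻¹ * (‖z‖⁻¹ * D z z)) * ‖z‖ ^ 2 :=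
            mul_le_mul_of_nonneg_right h1 (sq_nonneg _)
        _ = D z z := by field_simp
  refine ⟨c / 4, by positivity, ?_⟩
  filter_upwards [taylor (c / 4) (by positivity)] with x hx
  have h1 := (abs_le.1 hx).1
  have h2 := hcD (x - x₀)
  nlinarith

theorem exists_le_of_isUnit_hessian {f : ℂ → ℝ} {s₀ : ℂ}
    (hf0 : ∀ x, 0 ≤ f x) (hO : f =O[nhds s₀] fun x => ‖x - s₀‖ ^ 2)
    (hH : IsUnit (hessian f s₀)) :
    ∃ c > 0, ∀ᶠ x in nhds s₀, c * ‖x - s₀‖ ^ 2 ≤ f x := by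
  have hdiff : DifferentiableAt ℝ (fderiv ℝ f) s₀ := by
    -- The default value `0` of `fderiv` would make the Hessian zero, so its invertibility already
    -- contains differentiability.
    by_contra h
    have h0 : hessian f s₀ = 0 := by
      ext a b
      simp [hessian, fderiv_zero_of_not_differentiableAt h]
    rw [h0] at hH
    exact not_isUnit_zero hH
  refine exists_le_of_fderiv_fderiv_injective hf0 hO hdiff.hasFDerivAt ?_
  rw [injective_iff_map_eq_zero]
  intro z hz
  -- The row index of `hessian` is the outer direction of differentiation; the transpose avoids any
  -- appeal to symmetry.
  have hmul : (hessian f s₀)ᵀ *ᵥ ![z.re, z.im] = 0 := by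
    ext b
    have : fderiv ℝ (fderiv ℝ f) s₀ (z.re • (1 : ℂ) + z.im • Complex.I) = 0 := by
      simpa [Complex.re_add_im] using hz
    have h2 := congrArg (fun T => T (![1, Complex.I] b)) this
    simp only [map_add, map_smul, _root_.add_apply, _root_.smul_apply,
      smul_eq_mul, _root_.zero_apply] at h2
    simp [mulVec, dotProduct, hessian, Fin.sum_univ_two]
    linarith
  have hinj := Matrix.mulVec_injective_iff_isUnit.2 ((Matrix.isUnit_transpose _).2 hH)
  have := hinj (hmul.trans (mulVec_zero _).symm)
  apply Complex.ext
  · simpa using congrFun this 0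
  · simpa using congrFun this 1

/-! ### Lower bounds for shifted matrices, and quadratic growth of `η_n`. -/

/-- The polynomial part `P(s) = ∑ j ≤ d, s ^ j • P j` of a rational matrix function. -/
def RatFun.polyPart {k n d : ℕ} (R : RatFun k n d) (s : ℂ) : Matrix (Fin n) (Fin n) ℂ :=
  ∑ j : Fin (d + 1), s ^ (j : ℕ) • R.P j

theorem isUnit_of_mul_euclNorm_le {r : ℕ} {M : Matrix (Fin r) (Fin r) ℂ} {c : ℝ} (hc : 0 < c)
    (h : ∀ v, c * euclNorm v ≤ euclNorm (M *ᵥ v)) : IsUnit M := by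
  refine Matrix.mulVec_injective_iff_isUnit.1 ?_
  have : Function.Injective M.mulVecLin := by
    rw [injective_iff_map_eq_zero]
    intro v hv
    have h1 := h v
    rw [← Matrix.mulVecLin_apply, hv, euclNorm_eq_zero.2 rfl] at h1
    have h2 := euclNorm_nonneg v
    exact euclNorm_eq_zero.1 (by nlinarith)
  exact this

/-- Used with `F = 1` and with `F = Wᴴ V`, both contractions, to carry the bounds at `λ_*` over to
the iterates. -/
theorem mul_euclNorm_le_of_sub_smul {r : ℕ} {M F : Matrix (Fin r) (Fin r) ℂ} {s₀ s : ℂ} {c : ℝ}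
    (hF : ∀ v, euclNorm (F *ᵥ v) ≤ euclNorm v)
    (h : ∀ v, c * euclNorm v ≤ euclNorm ((M - s₀ • F) *ᵥ v)) (v : Fin r → ℂ) :
    (c - ‖s - s₀‖) * euclNorm v ≤ euclNorm ((M - s • F) *ᵥ v) := by
  have h1 : (M - s • F) *ᵥ v = (M - s₀ • F) *ᵥ v - (s - s₀) • (F *ᵥ v) := by
    rw [sub_mulVec, sub_mulVec, smul_mulVec, smul_mulVec, sub_smul]
    abel
  have h2 := sub_euclNorm_le ((M - s₀ • F) *ᵥ v) ((s - s₀) • (F *ᵥ v))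
  rw [← h1, euclNorm_smul] at h2
  have h3 := mul_le_mul_of_nonneg_left (hF v) (norm_nonneg (s - s₀))
  linarith [h v]

theorem RatFun.eval_mulVec {k n d : ℕ} (R : RatFun k n d) {s : ℂ} {v : Fin n → ℂ} {w : Fin k → ℂ}
    (hA : IsUnit (R.A - s • (1 : Matrix (Fin k) (Fin k) ℂ)))
    (hw : (R.A - s • (1 : Matrix (Fin k) (Fin k) ℂ)) *ᵥ w = R.B *ᵥ v) :
    R.eval s *ᵥ v = R.polyPart s *ᵥ v - R.C *ᵥ w := by
  have h1 : s • (1 : Matrix (Fin k) (Fin k) ℂ) - R.A = -(R.A - s • 1) := by abel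
  have h2 : IsUnit (s • (1 : Matrix (Fin k) (Fin k) ℂ) - R.A) := by
    rw [h1]; exact hA.neg
  have h3 : (s • (1 : Matrix (Fin k) (Fin k) ℂ) - R.A)⁻¹ *ᵥ (R.B *ᵥ v) = -w := by
    rw [← hw, mulVec_mulVec, show R.A - s • (1 : Matrix (Fin k) (Fin k) ℂ) = -(s • 1 - R.A) by abel,
      mul_neg, Matrix.nonsing_inv_mul _ ((Matrix.isUnit_iff_isUnit_det _).1 h2), neg_mulVec,
      one_mulVec]
  rw [RatFun.eval, add_mulVec, ← mulVec_mulVec, ← mulVec_mulVec, h3, mulVec_neg, sub_eq_add_neg,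
    RatFun.polyPart]

theorem mulVec_inv_mulVec {r : ℕ} {M : Matrix (Fin r) (Fin r) ℂ} (h : IsUnit M)
    (v : Fin r → ℂ) : M *ᵥ (M⁻¹ *ᵥ v) = v := by
  rw [mulVec_mulVec, Matrix.mul_nonsing_inv _ ((Matrix.isUnit_iff_isUnit_det _).1 h), one_mulVec]

theorem RatFun.eval_mulVec_isBigO {k n d : ℕ} (R : RatFun k n d) {s₀ : ℂ} {ξ : ℝ} (hξ : 0 < ξ)
    (hA : ∀ w, ξ * euclNorm w ≤
      euclNorm ((R.A - s₀ • (1 : Matrix (Fin k) (Fin k) ℂ)) *ᵥ w))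
    {v : Fin n → ℂ} (hv : R.eval s₀ *ᵥ v = 0) :
    (fun s => euclNorm (R.eval s *ᵥ v)) =O[nhds s₀] fun s => ‖s - s₀‖ := by
  have hA0 := isUnit_of_mul_euclNorm_le hξ hA
  have hP : (fun s => WithLp.toLp 2 (R.polyPart s *ᵥ v) - WithLp.toLp 2 (R.polyPart s₀ *ᵥ v))
      =O[nhds s₀] fun s => s - s₀ := by
    have : DifferentiableAt ℂ (fun s => WithLp.toLp 2 (R.polyPart s *ᵥ v)) s₀ := by
      simp only [RatFun.polyPart, sum_mulVec, smul_mulVec, WithLp.toLp_sum, WithLp.toLp_smul]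
      fun_prop
    exact this.isBigO_sub
  obtain ⟨K, hK⟩ := hP.bound
  obtain ⟨KC, hKC, hC⟩ := exists_euclNorm_mulVec_le R.C
  set w₀ := (R.A - s₀ • (1 : Matrix (Fin k) (Fin k) ℂ))⁻¹ *ᵥ (R.B *ᵥ v) with hw₀
  have hw₀' := mulVec_inv_mulVec hA0 (R.B *ᵥ v)
  rw [← hw₀] at hw₀'
  have hball : ∀ᶠ s in nhds s₀, ‖s - s₀‖ < ξ / 2 := by
    have := Metric.ball_mem_nhds s₀ (half_pos hξ)
    filter_upwards [this] with s hs
    simpa [dist_eq_norm] using hs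
  refine Asymptotics.IsBigO.of_bound (K + KC * (2 / ξ * euclNorm w₀)) ?_
  filter_upwards [hK, hball] with s hs hsb
  have hAs : ∀ w, ξ / 2 * euclNorm w ≤
      euclNorm ((R.A - s • (1 : Matrix (Fin k) (Fin k) ℂ)) *ᵥ w) := fun w =>
    (mul_le_mul_of_nonneg_right (by linarith) (euclNorm_nonneg w)).trans
      (mul_euclNorm_le_of_sub_smul (fun v => by rw [one_mulVec]) hA w)
  have hAsu := isUnit_of_mul_euclNorm_le (half_pos hξ) hAs
  set w₁ := (R.A - s • (1 : Matrix (Fin k) (Fin k) ℂ))⁻¹ *ᵥ w₀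
  have hw₁ : (R.A - s • (1 : Matrix (Fin k) (Fin k) ℂ)) *ᵥ w₁ = w₀ := mulVec_inv_mulVec hAsu w₀
  -- Resolvent identity: `(A - s)⁻¹ B v = w₀ + (s - s₀) (A - s)⁻¹ w₀`.
  have hw : (R.A - s • (1 : Matrix (Fin k) (Fin k) ℂ)) *ᵥ (w₀ + (s - s₀) • w₁) = R.B *ᵥ v := by
    rw [mulVec_add, mulVec_smul, hw₁, ← hw₀']
    simp only [sub_mulVec, smul_mulVec, one_mulVec, sub_smul]
    abel
  have e1 := R.eval_mulVec hAsu hw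
  have e0 := R.eval_mulVec hA0 hw₀'
  rw [hv] at e0
  have e2 : R.eval s *ᵥ v
      = (R.polyPart s *ᵥ v - R.polyPart s₀ *ᵥ v) + -((s - s₀) • (R.C *ᵥ w₁)) := by
    rw [e1, mulVec_add, mulVec_smul, ← sub_eq_zero.1 e0.symm]
    abel
  have h1 : euclNorm (R.polyPart s *ᵥ v - R.polyPart s₀ *ᵥ v) ≤ K * ‖s - s₀‖ := by
    simpa [euclNorm] using hs
  have h2 : euclNorm w₁ ≤ 2 / ξ * euclNorm w₀ := by
    have := hAs w₁
    rw [hw₁] at this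
    rw [div_mul_eq_mul_div, le_div_iff₀ hξ]
    linarith
  have h3 : euclNorm (R.C *ᵥ w₁) ≤ KC * (2 / ξ * euclNorm w₀) :=
    (hC w₁).trans (mul_le_mul_of_nonneg_left h2 hKC.le)
  rw [Real.norm_of_nonneg (euclNorm_nonneg _), norm_norm, e2]
  refine (euclNorm_add_le _ _).trans ?_
  rw [euclNorm_neg, euclNorm_smul]
  have h4 := mul_le_mul_of_nonneg_left h3 (norm_nonneg (s - s₀))
  linarith

theorem RatFun.exists_le_etaLast {k n d : ℕ} (hn : 0 < n) (R : RatFun k n d)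
    {s₀ : ℂ} {ξ : ℝ} (hξ : 0 < ξ)
    (hA : ∀ w, ξ * euclNorm w ≤
      euclNorm ((R.A - s₀ • (1 : Matrix (Fin k) (Fin k) ℂ)) *ᵥ w))
    {v : Fin n → ℂ} (hv0 : v ≠ 0) (hv : R.eval s₀ *ᵥ v = 0)
    (hH : IsUnit (hessian (R.etaLast hn) s₀)) :
    ∃ c > 0, ∀ᶠ s in nhds s₀, c * ‖s - s₀‖ ^ 2 ≤ R.etaLast hn s := by
  refine exists_le_of_isUnit_hessian (fun s => eta_nonneg _ _) ?_ hH
  have hvp := euclNorm_pos hv0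
  refine Asymptotics.IsBigO.trans ?_ ((R.eval_mulVec_isBigO hξ hA hv).pow 2)
  refine Asymptotics.IsBigO.of_bound ((euclNorm v ^ 2)⁻¹) (Filter.Eventually.of_forall fun s => ?_)
  have h0 : 0 ≤ R.etaLast hn s := eta_nonneg _ _
  rw [Real.norm_of_nonneg h0, Real.norm_of_nonneg (sq_nonneg _), ← div_eq_inv_mul, le_div_iff₀ (by positivity)]
  exact R.etaLast_mul_le hn s v

/-! ### Eigenvectors of the projected pencil -/

/-- The lower block rows make the `n`-blocks of `z` successive multiples by `s` of the last one,
`v`. If `v` vanished, the first block row and `hX` would force `z = 0`. -/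
theorem RatFun.IsProjEigenvalue.exists_mulVec {k n d r : ℕ} (hd : 0 < d) {R : RatFun k n d}
    {V W : Matrix (Fin k) (Fin r) ℂ} {s : ℂ} (h : R.IsProjEigenvalue V W s)
    (hX : IsUnit (Wᴴ * R.A * V - s • (Wᴴ * V))) :
    ∃ (v : Fin n → ℂ) (x : Fin r → ℂ), v ≠ 0 ∧
      (Wᴴ * R.A * V - s • (Wᴴ * V)) *ᵥ x = -((Wᴴ * R.B) *ᵥ v) ∧
      R.polyPart s *ᵥ v + (R.C * V) *ᵥ x = 0 := by
  obtain ⟨z, hz0, hz⟩ := h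
  obtain ⟨e, rfl⟩ : ∃ e, d = e + 1 := ⟨d - 1, by omega⟩
  set x : Fin r → ℂ := fun i => z (Sum.inl i) with hx
  set v : Fin n → ℂ := fun a => z (Sum.inr (Fin.last e, a)) with hv
  have htop : (Wᴴ * R.A * V - s • (Wᴴ * V)) *ᵥ x + (Wᴴ * R.B) *ᵥ v = 0 := by
    ext i
    have := congrFun hz (Sum.inl i)
    simp only [RatFun.projPencil, pencilConst, pencilLin, mulVec, dotProduct, Fintype.sum_sum_type,
      Fintype.sum_prod_type, Matrix.sub_apply, Matrix.smul_apply, fromBlocks_apply₁₁,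
      fromBlocks_apply₁₂, of_apply, Pi.zero_apply, Matrix.zero_apply, smul_zero, sub_zero,
      add_left_inj] at this
    rw [Fin.sum_univ_castSucc, Finset.sum_eq_zero (s := (Finset.univ : Finset (Fin e)))
      (fun j _ => by simp [(Fin.is_lt j).ne])] at this
    simpa [mulVec, dotProduct, hx, hv] using this
  have hstep : ∀ (j : Fin e) (a : Fin n),
      z (Sum.inr (j.castSucc, a)) = s * z (Sum.inr (j.succ, a)) := by
    intro j a
    have := congrFun hz (Sum.inr (j.succ, a))
    simp only [RatFun.projPencil, pencilConst, pencilLin, mulVec, dotProduct, Fintype.sum_sum_type,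
      Fintype.sum_prod_type, Matrix.sub_apply, Matrix.smul_apply, fromBlocks_apply₂₁,
      fromBlocks_apply₂₂, of_apply, Pi.zero_apply, Matrix.zero_apply, Fin.val_succ,
      Nat.succ_ne_zero, if_false, mul_zero, zero_mul, Finset.sum_const_zero, zero_add,
      sub_mul, Finset.sum_sub_distrib, smul_eq_mul, add_left_inj] at this
    have h1 : ∑ x : Fin (e + 1), ∑ y : Fin n,
        (if (j : ℕ) = x ∧ a = y then (-1 : ℂ) else 0) * z (Sum.inr (x, y))
        = -z (Sum.inr (j.castSucc, a)) := by
      rw [Finset.sum_eq_single j.castSucc, Finset.sum_eq_single a]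
      · simp
      · intro b _ hb
        simp [Ne.symm hb]
      · simp
      · intro b _ hb
        refine Finset.sum_eq_zero fun y _ => ?_
        rw [if_neg, zero_mul]
        rintro ⟨h, -⟩
        exact hb (Fin.ext h.symm)
      · simp
    have h2 : ∑ x : Fin (e + 1), ∑ y : Fin n,
        s * (if j.succ = x then (if a = y then (-1 : ℂ) else 0) else 0) * z (Sum.inr (x, y))
        = -(s * z (Sum.inr (j.succ, a))) := by
      rw [Finset.sum_eq_single j.succ, Finset.sum_eq_single a]
      · simp
      · intro b _ hb
        simp [Ne.symm hb]
      · simp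
      · intro b _ hb
        refine Finset.sum_eq_zero fun y _ => ?_
        rw [if_neg (Ne.symm hb)]; simp
      · simp
    rw [h1, h2] at this
    linear_combination -this
  have hpow : ∀ (j : Fin (e + 1)) (a : Fin n),
      z (Sum.inr (j, a)) = s ^ (j.rev : ℕ) * v a := by
    intro j
    induction j using Fin.reverseInduction with
    | last => intro a; simp [hv]
    | cast j ih =>
      intro a
      rw [hstep, ih, ← mul_assoc, ← pow_succ']
      congr 2
      simp [Fin.val_rev]
      omega
  refine ⟨v, x, ?_, eq_neg_of_add_eq_zero_left htop, ?_⟩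
  · intro hv0
    rw [hv0, mulVec_zero, add_zero] at htop
    have hx0 : x = 0 := Matrix.mulVec_injective_iff_isUnit.2 hX (htop.trans (mulVec_zero _).symm)
    apply hz0
    ext i
    rcases i with i | ⟨j, a⟩
    · exact congrFun hx0 i
    · rw [hpow, hv0]; simp
  · ext a
    have := congrFun hz (Sum.inr (0, a))
    simp only [RatFun.projPencil, pencilConst, pencilLin, mulVec, dotProduct, Fintype.sum_sum_type,
      Fintype.sum_prod_type, Matrix.sub_apply, Matrix.smul_apply, fromBlocks_apply₂₁,
      fromBlocks_apply₂₂, of_apply, Pi.zero_apply, Matrix.zero_apply, Fin.val_zero, if_true,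
      mul_zero, zero_mul, Finset.sum_const_zero, zero_add, sub_mul, Finset.sum_sub_distrib,
      smul_eq_mul, hpow] at this
    -- The leading block is `s ^ e • v`, so the term `-s * (-P_d)` supplies the missing summand `s ^
    -- d • P_d` of `P(s)`.
    have h2 : ∑ x : Fin (e + 1), ∑ y : Fin n,
        s * (if (0 : Fin (e + 1)) = x then -R.P (Fin.last (e + 1)) a y else 0)
          * (s ^ (x.rev : ℕ) * v y)
        = -(s ^ (e + 1) * ∑ y, R.P (Fin.last (e + 1)) a y * v y) := by
      rw [Finset.sum_eq_single 0, Finset.mul_sum, ← Finset.sum_neg_distrib]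
      · refine Finset.sum_congr rfl fun y _ => ?_
        simp; ring
      · intro b _ hb
        refine Finset.sum_eq_zero fun y _ => ?_
        rw [if_neg (Ne.symm hb)]; simp
      · simp
    have h1 : ∑ x : Fin (e + 1), ∑ y : Fin n,
        R.P x.rev.castSucc a y * (s ^ (x.rev : ℕ) * v y)
        = ∑ x : Fin (e + 1), s ^ (x : ℕ) * ∑ y, R.P x.castSucc a y * v y := by
      rw [← Equiv.sum_comp Fin.revPerm]
      refine Finset.sum_congr rfl fun x _ => ?_
      rw [Finset.mul_sum]
      refine Finset.sum_congr rfl fun y _ => ?_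
      simp; ring
    rw [h1, h2] at this
    rw [Pi.add_apply, RatFun.polyPart, sum_mulVec, Finset.sum_apply, Fin.sum_univ_castSucc]
    simp only [smul_mulVec, Pi.smul_apply, smul_eq_mul, Fin.val_castSucc, Fin.val_last,
      Pi.zero_apply]
    simp only [mulVec, dotProduct]
    rw [sub_neg_eq_add] at this
    rw [hx]
    linear_combination this

/-! ### Interpolation -/

theorem RatFun.IsRun.range_rightExpansion_le {k n d : ℕ} {R : RatFun k n d} {q : ℕ} {τ : ℂ} {N : ℕ}
    {lam : ℕ → ℂ} {r : ℕ → ℕ} {V W : (l : ℕ) → Matrix (Fin k) (Fin (r l)) ℂ}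
    (h : R.IsRun q τ N lam r V W) :
    LinearMap.range (R.rightExpansion q (lam N)).mulVecLin ≤ LinearMap.range (V N).mulVecLin := by
  cases N with
  | zero => rw [h.right_zero.2]
  | succ l =>
    rw [(h.right_succ l le_rfl).2]
    rintro _ ⟨x, rfl⟩
    exact ⟨Sum.elim 0 x, by simp [fromCols_mulVec]⟩

theorem RatFun.IsRun.conjTranspose_mul_self {k n d : ℕ} {R : RatFun k n d} {q : ℕ} {τ : ℂ} {N : ℕ}
    {lam : ℕ → ℂ} {r : ℕ → ℕ} {V W : (l : ℕ) → Matrix (Fin k) (Fin (r l)) ℂ}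
    (h : R.IsRun q τ N lam r V W) : (V N)ᴴ * V N = 1 ∧ (W N)ᴴ * W N = 1 := by
  cases N with
  | zero => exact ⟨h.right_zero.1, h.left_zero.1⟩
  | succ l => exact ⟨(h.right_succ l le_rfl).1, (h.left_succ l le_rfl).1⟩

theorem RatFun.inv_pow_mulVec_mem_range_rightExpansion {k n d : ℕ} (R : RatFun k n d) {q : ℕ}
    (μ : ℂ) {j : ℕ} (hj : j < q) (v : Fin n → ℂ) :
    (((R.A - μ • (1 : Matrix (Fin k) (Fin k) ℂ))⁻¹) ^ (j + 1)) *ᵥ (R.B *ᵥ v) ∈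
      LinearMap.range (R.rightExpansion q μ).mulVecLin := by
  refine ⟨fun jb => if jb.1 = ⟨j, hj⟩ then v jb.2 else 0, ?_⟩
  rw [mulVecLin_apply, mulVec_mulVec]
  ext i
  simp only [RatFun.rightExpansion, mulVec, dotProduct, Fintype.sum_prod_type, of_apply]
  rw [Finset.sum_eq_single ⟨j, hj⟩]
  · simp
  · intro b _ hb
    simp [hb]
  · simp

/-- If the right subspace contains the first two Krylov directions at `μ`, then a null vector of
the projected rational function at `s` is a null vector of `R(s)` up to `O(|s - μ| ^ 2)`. -/
theorem RatFun.euclNorm_eval_mulVec_le {k n d r : ℕ} (R : RatFun k n d) {ξ KB KC : ℝ} (hξ : 0 < ξ)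
    (hKB : ∀ v, euclNorm (R.B *ᵥ v) ≤ KB * euclNorm v) (hKC0 : 0 ≤ KC)
    (hKC : ∀ w, euclNorm (R.C *ᵥ w) ≤ KC * euclNorm w) {s μ : ℂ}
    (hAs : ∀ w, ξ * euclNorm w ≤ euclNorm ((R.A - s • (1 : Matrix (Fin k) (Fin k) ℂ)) *ᵥ w))
    (hAμ : ∀ w, ξ * euclNorm w ≤ euclNorm ((R.A - μ • (1 : Matrix (Fin k) (Fin k) ℂ)) *ᵥ w))
    {V W : Matrix (Fin k) (Fin r) ℂ} (hV : Vᴴ * V = 1) (hW : Wᴴ * W = 1)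
    (hX : ∀ y, ξ * euclNorm y ≤ euclNorm ((Wᴴ * R.A * V - s • (Wᴴ * V)) *ᵥ y))
    (hrange : ∀ v, ∀ j < 2,
      (((R.A - μ • (1 : Matrix (Fin k) (Fin k) ℂ))⁻¹) ^ (j + 1)) *ᵥ (R.B *ᵥ v) ∈
        LinearMap.range V.mulVecLin)
    {v : Fin n → ℂ} {x : Fin r → ℂ}
    (hx : (Wᴴ * R.A * V - s • (Wᴴ * V)) *ᵥ x = -((Wᴴ * R.B) *ᵥ v))
    (hv : R.polyPart s *ᵥ v + (R.C * V) *ᵥ x = 0) :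
    euclNorm (R.eval s *ᵥ v) ≤ 2 * KC * KB / ξ ^ 3 * ‖s - μ‖ ^ 2 * euclNorm v := by
  have hAsu := isUnit_of_mul_euclNorm_le hξ hAs
  have hAμu := isUnit_of_mul_euclNorm_le hξ hAμ
  set M := R.A - s • (1 : Matrix (Fin k) (Fin k) ℂ) with hM
  set G := (R.A - μ • (1 : Matrix (Fin k) (Fin k) ℂ))⁻¹
  set t := s - μ with ht
  have hshift : ∀ y, M *ᵥ y = (R.A - μ • (1 : Matrix (Fin k) (Fin k) ℂ)) *ᵥ y - t • y := by
    intro y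
    simp only [hM, ht, sub_mulVec, smul_mulVec, one_mulVec, sub_smul]
    abel
  set y₁ := G *ᵥ (R.B *ᵥ v)
  set y₂ := G *ᵥ y₁
  have hy₁ : M *ᵥ y₁ = R.B *ᵥ v - t • y₁ := by
    rw [hshift, mulVec_inv_mulVec hAμu]
  have hy₂ : M *ᵥ y₂ = y₁ - t • y₂ := by
    rw [hshift, mulVec_inv_mulVec hAμu]
  -- Truncated Neumann series: `(A - s)⁻¹ B v = y₁ + t y₂ + t² (A - s)⁻¹ y₂`, and the first two
  -- terms lie in the range of `V`.
  obtain ⟨p, hp⟩ : y₁ + t • y₂ ∈ LinearMap.range V.mulVecLin := by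
    refine Submodule.add_mem _ ?_ (Submodule.smul_mem _ _ ?_)
    · have := hrange v 0 (by norm_num)
      rwa [zero_add, pow_one] at this
    · have := hrange v 1 (by norm_num)
      rwa [one_add_one_eq_two, pow_two, ← mulVec_mulVec] at this
  rw [mulVecLin_apply] at hp
  set w := M⁻¹ *ᵥ y₂
  have hw : M *ᵥ w = y₂ := mulVec_inv_mulVec hAsu y₂
  have hproj : ∀ y, (Wᴴ * R.A * V - s • (Wᴴ * V)) *ᵥ y = Wᴴ *ᵥ (M *ᵥ (V *ᵥ y)) := by
    intro y
    rw [mulVec_mulVec, mulVec_mulVec, hM, Matrix.mul_sub, Matrix.sub_mul]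
    simp [Matrix.mul_assoc]
  have hsol : M *ᵥ (V *ᵥ p + t ^ 2 • w) = R.B *ᵥ v := by
    rw [hp, mulVec_add, mulVec_add, mulVec_smul, mulVec_smul, hy₁, hy₂, hw, smul_sub, smul_smul,
      pow_two]
    abel
  -- The reduced solution is `-x`, so `p + x` is the Petrov–Galerkin error; only the remainder `t²
  -- y₂` drives it.
  have hu : (Wᴴ * R.A * V - s • (Wᴴ * V)) *ᵥ (p + x) = -(t ^ 2 • (Wᴴ *ᵥ y₂)) := by
    have h1 : M *ᵥ (V *ᵥ p) = R.B *ᵥ v - t ^ 2 • y₂ := by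
      rw [← hsol, mulVec_add, mulVec_smul, hw, add_sub_cancel_right]
    rw [mulVec_add, hx, hproj, h1, mulVec_sub, mulVec_smul, mulVec_mulVec]
    abel
  have heval : R.eval s *ᵥ v = -(R.C *ᵥ (V *ᵥ (p + x) + t ^ 2 • w)) := by
    rw [R.eval_mulVec hAsu hsol, eq_neg_of_add_eq_zero_left hv, ← mulVec_mulVec]
    simp only [mulVec_add]
    abel
  have b₁ : ξ * euclNorm y₁ ≤ KB * euclNorm v := by
    have := hAμ y₁
    rw [mulVec_inv_mulVec hAμu] at this
    exact this.trans (hKB v)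
  have b₂ : ξ * euclNorm y₂ ≤ euclNorm y₁ := by
    have := hAμ y₂
    rwa [mulVec_inv_mulVec hAμu] at this
  have b₃ : ξ * euclNorm w ≤ euclNorm y₂ := by
    have := hAs w
    rwa [hw] at this
  have b₄ : ξ * euclNorm (p + x) ≤ ‖t‖ ^ 2 * euclNorm y₂ := by
    refine (hX (p + x)).trans ?_
    rw [hu, euclNorm_neg, euclNorm_smul, norm_pow]
    exact mul_le_mul_of_nonneg_left (euclNorm_conjTranspose_mulVec_le hW _) (by positivity)
  have b₅ : euclNorm y₂ ≤ KB * euclNorm v / ξ ^ 2 := by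
    rw [le_div_iff₀ (by positivity)]
    nlinarith
  -- The factor 2 counts the Galerkin error and the truncation error, each at most `‖t‖² ‖y₂‖ / ξ`.
  have b₆ : ξ * euclNorm (V *ᵥ (p + x) + t ^ 2 • w) ≤ 2 * ‖t‖ ^ 2 * euclNorm y₂ := by
    have h1 := euclNorm_add_le (V *ᵥ (p + x)) (t ^ 2 • w)
    rw [euclNorm_smul, norm_pow, euclNorm_mulVec_of_conjTranspose_mul_self_eq_one hV] at h1
    have h2 := mul_le_mul_of_nonneg_left b₃ (sq_nonneg ‖t‖)
    have h3 := mul_le_mul_of_nonneg_left h1 hξ.le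
    nlinarith
  rw [heval, euclNorm_neg]
  refine (hKC _).trans ?_
  have b₇ : euclNorm (V *ᵥ (p + x) + t ^ 2 • w) ≤
      2 * ‖t‖ ^ 2 * (KB * euclNorm v / ξ ^ 2) / ξ := by
    rw [le_div_iff₀ hξ, mul_comm]
    exact b₆.trans (mul_le_mul_of_nonneg_left b₅ (by positivity))
  refine (mul_le_mul_of_nonneg_left b₇ hKC0).trans (le_of_eq ?_)
  field_simp

end RationalEig

/-! ### The main theorem. -/

open Matrix in
theorem theorem2p3 {k n d : ℕ} (hn : 0 < n) (hd : 0 < d) (R : RationalEig.RatFun k n d)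
    (lamStar : ℂ) (hsimple : R.IsSimpleEigenvalue lamStar)
    (ξ : ℝ) (hξ : 0 < ξ)
    (hA : (ξ : EReal) ≤
      RationalEig.sigmaMin (R.A - lamStar • (1 : Matrix (Fin k) (Fin k) ℂ)))
    (hHess : IsUnit (RationalEig.hessian (R.etaLast hn) lamStar)) :
    ∃ K > (0 : ℝ), ∃ δ > (0 : ℝ),
      ∀ (q : ℕ), 2 ≤ q → ∀ (τ : ℂ) (l : ℕ) (lam : ℕ → ℂ) (r : ℕ → ℕ)
        (V W : (i : ℕ) → Matrix (Fin k) (Fin (r i)) ℂ),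
        R.IsRun q τ l lam r V W →
        (ξ : EReal) ≤
          RationalEig.sigmaMin ((W l)ᴴ * R.A * V l - lamStar • ((W l)ᴴ * V l)) →
        ‖lam l - lamStar‖ < δ → ‖lam (l + 1) - lamStar‖ < δ →
        ‖lam (l + 1) - lamStar‖ ≤ K * ‖lam l - lamStar‖ ^ 2 := by
  open RationalEig in
  obtain ⟨⟨v₀, hv₀, hRv₀⟩, -⟩ := hsimple
  have hA' := mul_euclNorm_le_of_le_sigmaMin hξ.le hA
  obtain ⟨c, hc, hgrow⟩ := R.exists_le_etaLast hn hξ hA' hv₀ hRv₀ hHess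
  obtain ⟨ρ, hρ, hgrow⟩ := Metric.eventually_nhds_iff_ball.1 hgrow
  obtain ⟨KB, hKB0, hKB⟩ := exists_euclNorm_mulVec_le R.B
  obtain ⟨KC, hKC0, hKC⟩ := exists_euclNorm_mulVec_le R.C
  -- The residual constant at level `ξ / 2`, the bound that survives within `ξ / 2` of `λ_*`,
  -- divided by the growth rate `√c` of the smallest singular value.
  set L := 2 * KC * KB / (ξ / 2) ^ 3 / Real.sqrt c with hL
  have hcs := Real.sqrt_pos.2 hc
  have hL0 : 0 < L := by positivity
  refine ⟨4 * L, by positivity, min (min ρ (ξ / 2)) (1 / (4 * L)), by positivity, ?_⟩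
  intro q hq τ l lam r V W hrun hX hl hl1
  obtain ⟨⟨-, hlξ⟩, -⟩ := by simpa only [lt_min_iff] using hl
  obtain ⟨⟨hl1ρ, hl1ξ⟩, hl1L⟩ := by simpa only [lt_min_iff] using hl1
  set s := lam (l + 1)
  set μ := lam l
  obtain ⟨hV, hW⟩ := hrun.conjTranspose_mul_self
  have hX' := mul_euclNorm_le_of_le_sigmaMin hξ.le hX
  have hAnear : ∀ z, ‖z - lamStar‖ < ξ / 2 → ∀ w, ξ / 2 * euclNorm w ≤
      euclNorm ((R.A - z • (1 : Matrix (Fin k) (Fin k) ℂ)) *ᵥ w) := fun z hz w =>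
    (mul_le_mul_of_nonneg_right (by linarith) (euclNorm_nonneg w)).trans
      (mul_euclNorm_le_of_sub_smul (fun v => by rw [one_mulVec]) hA' w)
  have hXs : ∀ y, ξ / 2 * euclNorm y ≤
      euclNorm (((W l)ᴴ * R.A * V l - s • ((W l)ᴴ * V l)) *ᵥ y) := fun y =>
    (mul_le_mul_of_nonneg_right (by linarith) (euclNorm_nonneg y)).trans
      (mul_euclNorm_le_of_sub_smul (fun v => by
        rw [← mulVec_mulVec]
        exact (euclNorm_conjTranspose_mulVec_le hW _).trans_eq
          (euclNorm_mulVec_of_conjTranspose_mul_self_eq_one hV v)) hX' y)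
  have hξ2 := half_pos hξ
  obtain ⟨v, x, hv0, hx, hv⟩ := (hrun.eigenvalue l le_rfl).exists_mulVec hd
    (isUnit_of_mul_euclNorm_le hξ2 hXs)
  have hres := R.euclNorm_eval_mulVec_le hξ2 hKB hKC0.le hKC (hAnear s hl1ξ) (hAnear μ hlξ) hV hW hXs
    -- Here `q ≥ 2` enters: both Krylov directions are present.
    (fun v j hj => hrun.range_rightExpansion_le
      (R.inv_pow_mulVec_mem_range_rightExpansion _ (hj.trans_le hq) v)) hx hv
  have heta := R.etaLast_mul_le hn s v
  have hgs := hgrow s (by simpa [dist_eq_norm] using hl1ρ)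
  have hvp := euclNorm_pos hv0
  have hkey : ‖s - lamStar‖ ≤ L * ‖s - μ‖ ^ 2 := by
    have h1 : (Real.sqrt c * ‖s - lamStar‖ * euclNorm v) ^ 2 ≤
        (2 * KC * KB / (ξ / 2) ^ 3 * ‖s - μ‖ ^ 2 * euclNorm v) ^ 2 := by
      rw [mul_pow, mul_pow, Real.sq_sqrt hc.le]
      refine (mul_le_mul_of_nonneg_right hgs (sq_nonneg _)).trans (heta.trans ?_)
      exact pow_le_pow_left₀ (euclNorm_nonneg _) hres 2
    have h2 := le_of_mul_le_mul_right
      ((sq_le_sq₀ (by positivity) (by positivity)).1 h1) hvp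
    rw [hL, div_mul_eq_mul_div, le_div_iff₀ hcs]
    linarith
  have htri : ‖s - μ‖ ≤ ‖s - lamStar‖ + ‖μ - lamStar‖ := by
    have := norm_sub_le (s - lamStar) (μ - lamStar)
    rwa [sub_sub_sub_cancel_right] at this
  rw [lt_div_iff₀ (by positivity)] at hl1L
  have h3 : ‖s - μ‖ ^ 2 ≤ 2 * ‖s - lamStar‖ ^ 2 + 2 * ‖μ - lamStar‖ ^ 2 := by
    nlinarith [norm_nonneg (s - μ), sq_nonneg (‖s - lamStar‖ - ‖μ - lamStar‖)]
  have h4 := mul_le_mul_of_nonneg_left h3 hL0.le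
  -- Now `|s - λ_*| ≤ 2L |s - λ_*|² + 2L |μ - λ_*|²`; as `|s - λ_*| < 1 / (4L)`, the first term is
  -- at most half the left side and is absorbed, whence `K = 4L`.
  nlinarith [mul_le_mul_of_nonneg_left hl1L.le (norm_nonneg (s - lamStar))]
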